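/- Let $m$ and $i$ be positive integers. A word $w$ over an $m$-letter alphabet encounters a pattern $p=p_1\cdots p_n$ in the abelian sense if $w$ contains a factor $u_1\cdots u_n$ with nonempty words $u_1,\dots,u_n$ such that $u_j$ is a rearrangement of the letters of $u_k$ whenever $p_j=p_k$. The pattern $p$ is $m$-unavoidable in the abelian sense if only words of bounded length over an $m$-letter alphabet fail to encounter $p$ in the abelian sense; its abelian Ramsey length $L_{\mathrm{ab}}(m,p)$ is then the least $n$ such that every word of length $n$ over an $m$-letter alphabet encounters $p$ in the abelian sense. The Zimin patterns are $Z_1=a_1$ and $Z_i=Z_{i-1}a_iZ_{i-1}$ for $i\ge 2$, with distinct variables $a_1,a_2,\dots$. For every $m\ge 4$ and $i\ge 1$ the pattern $Z_i$ is $m$-unavoidable in the abelian sense; for every $m\ge 4$ and $j\ge 1$ the series $$S_j=S_j(m)=\sum_{\ell=1}^{\infty}\frac{1}{m^{2^j\ell}}\sum_{i_1+\cdots+i_m=\ell}\binom{\ell}{i_1,\ldots,i_m}^{2^j}$$ (the inner sum being over nonnegative integers $i_1,\dots,i_m$) converges; and for all $m\ge 4$ and $i\ge 2$ $$L_{\mathrm{ab}}(m,Z_i)\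 \ge\ (1+o(1))\sqrt{2\prod_{j=1}^{i-1}S_j^{-1}},$$ where $o(1)$ stands for a function of $(m,i)$ that tends to $0$ as $m+i\to\infty$ (in particular as $i\to\infty$ for fixed $m$, and as $m\to\infty$ for fixed $i$). -/

import Mathlib

open Filter Topology

/-- The word `w` encounters the pattern `p = p₁ ⋯ pₙ` in the abelian sense: `w` contains a factor
`u₁ ⋯ uₙ` where the `uⱼ` are nonempty words and `uⱼ` is a rearrangement of `uₖ` whenever
`pⱼ = pₖ`. -/
def AbelianEncounters {V A : Type*} (p : List V) (w : List A) : Prop :=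
  ∃ u : Fin p.length → List A,
    (∀ j, u j ≠ []) ∧
    (∀ j k, p.get j = p.get k → (u j).Perm (u k)) ∧
    (List.ofFn u).flatten <:+: w

/-- `p` is `m`-avoidable in the abelian sense: arbitrarily long words over an `m`-letter alphabet
avoid `p` in the abelian sense. -/
def AbelianAvoidable {V : Type*} (m : ℕ) (p : List V) : Prop :=
  ∀ N : ℕ, ∃ w : List (Fin m), N ≤ w.length ∧ ¬ AbelianEncounters p w

/-- The abelian Ramsey length of a pattern `p` that is `m`-unavoidable in the abelian sense: the
least `n` such that every word of length `n` over an `m`-letter alphabet encounters `p` in the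
abelian sense. -/
noncomputable def abelianRamseyLength {V : Type*} (m : ℕ) (p : List V) : ℕ :=
  sInf {n : ℕ | ∀ w : List (Fin m), w.length = n → AbelianEncounters p w}

/-- The Zimin patterns, with the variable `aᵢ` represented by the number `i`: `Z₁ = a₁` and
`Zᵢ = Zᵢ₋₁ aᵢ Zᵢ₋₁` (and `Z₀` is the empty word). -/
def zimin : ℕ → List ℕ
  | 0 => []
  | i + 1 => zimin i ++ [i + 1] ++ zimin i

/-- The term `m ^ (-k ℓ) * ∑_{i₁ + ⋯ + iₘ = ℓ} (ℓ; i₁, …, iₘ) ^ k`. -/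
noncomputable def multinomialTerm (m k l : ℕ) : ℝ :=
  (1 / (m : ℝ) ^ (k * l)) *
    ∑ c ∈ Finset.piAntidiag (Finset.univ : Finset (Fin m)) l,
      (Nat.multinomial Finset.univ c : ℝ) ^ k

/-- The number `∑_{ℓ ≥ 1} m ^ (-k ℓ) * ∑_{i₁ + ⋯ + iₘ = ℓ} (ℓ; i₁, …, iₘ) ^ k`. -/
noncomputable def multinomialSeries (m k : ℕ) : ℝ :=
  ∑' l : ℕ, multinomialTerm m k (l + 1)

/-! The lower bound is a first-moment argument. In a uniformly random word of length `n`, fix where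
an occurrence of `Z_{k+1}` starts, the letter counts of `a_1, …, a_k`, and the length of the block
for `a_{k+1}`, which occurs only once and is unconstrained. Since `a_j` occurs `2^(k+1-j)` times,
the probability is at most the product of the corresponding powers of `multinomial / m^length`.
Summing over letter counts gives at most `∏ S_j`, and there are at most `n²/2` choices of start and
block length. If every word encounters the pattern, then `1 ≤ (n²/2) ∏ S_j`; no error term is lost.

Convergence: the multinomial probabilities of total `l` sum to 1 and are `O(l^(-3/2))` for fixed `m
≥ 4`, so their power sums are dominated by a convergent series. Unavoidability, which makes the
Ramsey length an attained minimum, is Zimin's pigeonhole argument. -/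

/-! ### Decay of multinomial probabilities -/

/-- `q^c / c!` is maximal at `c = q`. Multiplied over the letters, this says that balanced counts
minimise the product of factorials, up to the remainder `r`. -/
theorem factorial_mul_pow_le_factorial_mul_pow (q c : ℕ) :
    q.factorial * q ^ c ≤ c.factorial * q ^ q := by
  rcases le_total q c with h | h
  · obtain ⟨d, rfl⟩ := Nat.exists_eq_add_of_le h
    calc q.factorial * q ^ (q + d) = q.factorial * q ^ d * q ^ q := by ring
      _ ≤ q.factorial * (q + 1) ^ d * q ^ q := by gcongr; omega
      _ ≤ _ := by gcongr; exact Nat.factorial_mul_pow_le_factorial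
  · obtain ⟨d, rfl⟩ := Nat.exists_eq_add_of_le h
    rw [← Nat.factorial_mul_ascFactorial]
    calc c.factorial * (c + 1).ascFactorial d * (c + d) ^ c
        ≤ c.factorial * (c + d) ^ d * (c + d) ^ c := by
          gcongr; exact Nat.ascFactorial_le_pow_add c d
      _ = _ := by ring

theorem factorial_pow_mul_pow_le_prod_factorial {m q r : ℕ} (hq : 0 < q) (c : Fin m → ℕ)
    (hc : ∑ a, c a = m * q + r) :
    q.factorial ^ m * q ^ r ≤ ∏ a, (c a).factorial := by
  have h : ∏ a, (q.factorial * q ^ c a) ≤ ∏ a, ((c a).factorial * q ^ q) :=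
    Finset.prod_le_prod' fun a _ => factorial_mul_pow_le_factorial_mul_pow q (c a)
  rw [Finset.prod_mul_distrib, Finset.prod_mul_distrib, Finset.prod_pow_eq_pow_sum, hc] at h
  simp only [Finset.prod_const, Finset.card_univ, Fintype.card_fin] at h
  refine Nat.le_of_mul_le_mul_right (c := q ^ (m * q)) ?_ (by positivity)
  calc q.factorial ^ m * q ^ r * q ^ (m * q) = q.factorial ^ m * q ^ (m * q + r) := by ring
    _ ≤ (∏ a, (c a).factorial) * (q ^ q) ^ m := h
    _ = _ := by ring

theorem multinomial_mul_factorial_pow_le {m q r : ℕ} (hq : 0 < q) (hr : r < m) (c : Fin m → ℕ)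
    (hc : ∑ a, c a = m * q + r) :
    Nat.multinomial Finset.univ c * q.factorial ^ m ≤ (m * q).factorial * (2 * m) ^ r := by
  have h1 := Nat.multinomial_spec Finset.univ c
  have h2 := factorial_pow_mul_pow_le_prod_factorial hq c hc
  have hr' : m * q + r ≤ 2 * m * q := by nlinarith
  refine Nat.le_of_mul_le_mul_right (c := q ^ r) ?_ (by positivity)
  calc Nat.multinomial Finset.univ c * q.factorial ^ m * q ^ r
      = (q.factorial ^ m * q ^ r) * Nat.multinomial Finset.univ c := by ring
    _ ≤ (∏ a, (c a).factorial) * Nat.multinomial Finset.univ c := by gcongr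
    _ = (m * q).factorial * (m * q + 1).ascFactorial r := by
        rw [h1, hc, Nat.factorial_mul_ascFactorial]
    _ ≤ (m * q).factorial * (m * q + r) ^ r := by
        gcongr; exact Nat.ascFactorial_le_pow_add _ _
    _ ≤ (m * q).factorial * (2 * m * q) ^ r := by gcongr
    _ = _ := by ring

/-- The Stirling sequence decreases from its first value `e / √2 ≤ 2`. -/
theorem factorial_le_stirling {n : ℕ} (hn : n ≠ 0) :
    (n.factorial : ℝ) ≤ 2 * √(2 * n) * (n / Real.exp 1) ^ n := by
  obtain ⟨k, rfl⟩ := Nat.exists_eq_succ_of_ne_zero hn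
  have h := Stirling.stirlingSeq'_antitone (Nat.zero_le k)
  simp only [Function.comp, Nat.succ_eq_add_one, zero_add, Stirling.stirlingSeq_one] at h
  have h2 : Real.exp 1 / √2 ≤ 2 := by
    rw [div_le_iff₀ (by positivity)]
    have := Real.exp_one_lt_d9
    have : (1.4 : ℝ) ≤ √2 := Real.le_sqrt_of_sq_le (by norm_num)
    linarith
  have h3 := h.trans h2
  rw [Stirling.stirlingSeq, div_le_iff₀ (by positivity)] at h3
  simpa [mul_assoc] using h3

theorem sqrt_mul_pow_le_factorial (n : ℕ) :
    √(2 * n) * (n / Real.exp 1) ^ n ≤ (n.factorial : ℝ) := by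
  refine le_trans ?_ (Stirling.le_factorial_stirling n)
  gcongr
  nlinarith [Real.pi_gt_three]

/-- Stirling at the balanced point `l = m q + r` gives decay of order `q^(-(m-1)/2)`, and `m ≥ 4`
makes this at least as fast as `l^(-3/2)`. -/
theorem multinomial_div_pow_le {m : ℕ} (hm : 4 ≤ m) {l : ℕ} (hl : m ≤ l) (c : Fin m → ℕ)
    (hc : ∑ a, c a = l) :
    (Nat.multinomial Finset.univ c : ℝ) / (m : ℝ) ^ l ≤
      2 ^ m * (2 * √m) * √m ^ 3 / √l ^ 3 := by
  obtain ⟨q, r, hr, rfl⟩ : ∃ q r, r < m ∧ l = m * q + r :=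
    ⟨l / m, l % m, Nat.mod_lt _ (by omega), (Nat.div_add_mod l m).symm⟩
  have hq : 0 < q := by
    rcases Nat.eq_zero_or_pos q with rfl | h
    · omega
    · exact h
  have hm0 : (0 : ℝ) < m := by positivity
  have hq0 : (0 : ℝ) < q := by positivity
  have h1 : (Nat.multinomial Finset.univ c : ℝ) * (q.factorial : ℝ) ^ m ≤
      ((m * q).factorial : ℝ) * (2 * m) ^ r := by
    exact_mod_cast multinomial_mul_factorial_pow_le hq hr c hc
  have h2 := factorial_le_stirling (n := m * q) (by positivity)
  have h3 : (√(2 * q) * (q / Real.exp 1) ^ q) ^ m ≤ (q.factorial : ℝ) ^ m :=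
    pow_le_pow_left₀ (by positivity) (sqrt_mul_pow_le_factorial q) m
  push_cast at h2
  set M : ℝ := (Nat.multinomial Finset.univ c : ℝ) with hM
  have hM0 : 0 ≤ M := by positivity
  set X : ℝ := (q / Real.exp 1) ^ (q * m) with hX
  have hX0 : 0 < X := by positivity
  have e1 : (m * q / Real.exp 1 : ℝ) ^ (m * q) = m ^ (m * q) * X := by
    rw [hX, mul_div_assoc, mul_pow, mul_comm q m]
  have h4 : M * √(2 * q) ^ m ≤ 2 * √(2 * (m * q)) * (m : ℝ) ^ (m * q + r) * 2 ^ r := by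
    refine le_of_mul_le_mul_right (a := X) ?_ hX0
    calc M * √(2 * q) ^ m * X = M * (√(2 * q) * (q / Real.exp 1) ^ q) ^ m := by
          rw [hX, mul_pow, ← pow_mul]; ring
      _ ≤ M * (q.factorial : ℝ) ^ m := by gcongr
      _ ≤ _ := h1
      _ ≤ (2 * √(2 * (m * q)) * (m * q / Real.exp 1) ^ (m * q)) * (2 * m) ^ r := by gcongr
      _ = _ := by rw [e1]; ring
  have hs : √(2 * (m * q) : ℝ) = √m * √(2 * q) := by
    rw [← Real.sqrt_mul (by positivity)]; congr 1; ring
  have hs1 : 1 ≤ √(2 * q : ℝ) := by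
    rw [Real.one_le_sqrt]
    have : (1 : ℝ) ≤ q := by exact_mod_cast hq
    linarith
  have hl' : √((m * q + r : ℕ) : ℝ) ≤ √m * √(2 * q) := by
    rw [← hs]
    apply Real.sqrt_le_sqrt
    have : m * q + r ≤ 2 * (m * q) := by nlinarith
    exact_mod_cast this
  have hl0 : 0 < √((m * q + r : ℕ) : ℝ) := Real.sqrt_pos.2 (by positivity)
  rw [div_le_iff₀ (by positivity), div_mul_eq_mul_div, le_div_iff₀ (by positivity)]
  obtain ⟨d, rfl⟩ := Nat.exists_eq_add_of_le hm
  set S := √(2 * q : ℝ)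
  set s := √((4 + d : ℕ) : ℝ)
  refine le_of_mul_le_mul_right (a := S) ?_ (by positivity)
  calc M * √(((4 + d) * q + r : ℕ) : ℝ) ^ 3 * S ≤ M * (s * S) ^ 3 * S := by gcongr
    _ = M * S ^ 4 * s ^ 3 := by ring
    -- Only four of the `m` factors `√(2q)` are needed: one cancels that of `√(2mq)`, three give the
    -- decay.
    _ ≤ M * S ^ (4 + d) * s ^ 3 := by
        gcongr
    _ ≤ 2 * (s * S) * ((4 + d : ℕ) : ℝ) ^ ((4 + d) * q + r) * 2 ^ r * s ^ 3 := by
        rw [← hs]; gcongr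
    _ ≤ 2 * (s * S) * ((4 + d : ℕ) : ℝ) ^ ((4 + d) * q + r) * 2 ^ (4 + d) * s ^ 3 := by
        gcongr
        norm_num
    _ = _ := by ring

/-! ### Convergence of the series -/

theorem multinomialTerm_eq_sum {m : ℕ} (k l : ℕ) :
    multinomialTerm m k l = ∑ c ∈ Finset.piAntidiag (Finset.univ : Finset (Fin m)) l,
      ((Nat.multinomial Finset.univ c : ℝ) / (m : ℝ) ^ l) ^ k := by
  rw [multinomialTerm, Finset.mul_sum]
  refine Finset.sum_congr rfl fun c _ => ?_
  rw [div_pow, ← pow_mul, mul_comm l k]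
  ring

theorem sum_multinomial_div_pow {m : ℕ} (hm : 0 < m) (l : ℕ) :
    ∑ c ∈ Finset.piAntidiag (Finset.univ : Finset (Fin m)) l,
      (Nat.multinomial Finset.univ c : ℝ) / (m : ℝ) ^ l = 1 := by
  have h := Finset.sum_pow_eq_sum_piAntidiag (Finset.univ : Finset (Fin m)) (fun _ => (1 : ℝ)) l
  simp at h
  rw [← Finset.sum_div, ← h, div_self (by positivity)]

theorem multinomialTerm_nonneg (m k l : ℕ) : 0 ≤ multinomialTerm m k l := by
  rw [multinomialTerm_eq_sum]; positivity

/-- For probabilities `p ≤ B` with sum 1, `∑ p^k ≤ ∑ p² ≤ B ∑ p = B`. -/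
theorem multinomialTerm_le_of_forall_le {m k l : ℕ} (hm : 0 < m) (hk : 2 ≤ k) {B : ℝ}
    (hB : ∀ c : Fin m → ℕ, ∑ a, c a = l →
      (Nat.multinomial Finset.univ c : ℝ) / (m : ℝ) ^ l ≤ B) :
    multinomialTerm m k l ≤ B := by
  have h1 := sum_multinomial_div_pow hm l
  have hle : ∀ c ∈ Finset.piAntidiag (Finset.univ : Finset (Fin m)) l,
      (Nat.multinomial Finset.univ c : ℝ) / (m : ℝ) ^ l ≤ 1 := fun c hc => by
    rw [← h1]
    exact Finset.single_le_sum
      (f := fun c => (Nat.multinomial Finset.univ c : ℝ) / (m : ℝ) ^ l)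
      (fun _ _ => by positivity) hc
  rw [multinomialTerm_eq_sum]
  calc _ ≤ ∑ c ∈ Finset.piAntidiag (Finset.univ : Finset (Fin m)) l,
        B * ((Nat.multinomial Finset.univ c : ℝ) / (m : ℝ) ^ l) := by
        refine Finset.sum_le_sum fun c hc => ?_
        calc _ ≤ ((Nat.multinomial Finset.univ c : ℝ) / (m : ℝ) ^ l) ^ 2 :=
              pow_le_pow_of_le_one (by positivity) (hle c hc) hk
          _ ≤ _ := by
              rw [sq]; gcongr; exact hB c (Finset.mem_piAntidiag.1 hc).1
    _ = B := by rw [← Finset.mul_sum, h1, mul_one]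

theorem summable_multinomialTerm {m k : ℕ} (hm : 4 ≤ m) (hk : 2 ≤ k) :
    Summable (fun l : ℕ => multinomialTerm m k (l + 1)) := by
  -- The decay estimate needs `l ≥ m`, so the series is restarted there.
  rw [summable_nat_add_iff (f := fun l => multinomialTerm m k l) 1,
    ← summable_nat_add_iff (f := fun l => multinomialTerm m k l) m]
  have hs : Summable fun l : ℕ => 2 ^ m * (2 * √(m : ℝ)) * √(m : ℝ) ^ 3 *
      (1 / ((l + m : ℕ) : ℝ) ^ (3 / 2 : ℝ)) :=
    ((summable_nat_add_iff m).2
      (Real.summable_one_div_nat_rpow.2 (by norm_num : (1 : ℝ) < 3 / 2))).mul_left _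
  refine Summable.of_nonneg_of_le (fun l => multinomialTerm_nonneg _ _ _) (fun l => ?_) hs
  refine multinomialTerm_le_of_forall_le (by omega) hk fun c hc => ?_
  refine (multinomial_div_pow_le hm (by omega) c hc).trans_eq ?_
  have h : √((l + m : ℕ) : ℝ) ^ 3 = ((l + m : ℕ) : ℝ) ^ (3 / 2 : ℝ) := by
    rw [Real.sqrt_eq_rpow, ← Real.rpow_natCast, ← Real.rpow_mul (by positivity)]
    norm_num
  rw [h, div_eq_mul_one_div]

/-! ### Unavoidability of Zimin patterns -/

theorem lt_of_mem_zimin {i v : ℕ} (h : v ∈ zimin i) : v ≤ i := by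
  induction i with
  | zero => simp [zimin] at h
  | succ i ih =>
    simp only [zimin, List.mem_append, List.mem_singleton] at h
    rcases h with (h | h) | h
    · have := ih h; omega
    · omega
    · have := ih h; omega

theorem abelianEncounters_of_flatMap_infix {V A : Type*} {p : List V} {w : List A}
    (f : V → List A) (hf : ∀ v, f v ≠ []) (h : p.flatMap f <:+: w) : AbelianEncounters p w := by
  refine ⟨fun j => f (p.get j), fun j => hf _, fun j k hjk => by beta_reduce; rw [hjk], ?_⟩
  have : List.ofFn (fun j => f (p.get j)) = p.map f := by
    conv_rhs => rw [← List.ofFn_get p, List.map_ofFn]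
    rfl
  rwa [this, ← List.flatMap_def]

/-- Zimin words are unavoidable: every sufficiently long word contains a homomorphic image. -/
theorem exists_forall_zimin_flatMap_infix (A : Type*) [Finite A] [Nonempty A] (i : ℕ) :
    ∃ N : ℕ, ∀ w : List A, N ≤ w.length →
      ∃ f : ℕ → List A, (∀ v, f v ≠ []) ∧ (zimin i).flatMap f <:+: w := by
  have := Fintype.ofFinite A
  induction i with
  | zero => exact ⟨0, fun w _ => ⟨fun _ => [Classical.arbitrary A], by simp, by simp [zimin]⟩⟩
  | succ i ih =>
    obtain ⟨N, hN⟩ := ih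
    set K := Fintype.card A ^ N with hK
    -- `K + 1` blocks of length `N`, each followed by a spacer letter: two blocks coincide, and the
    -- spacer keeps the gap `x` between them nonempty.
    refine ⟨(K + 1) * (N + 1), fun w hw => ?_⟩
    have hlen : ∀ k : Fin (K + 1), ((w.drop (k * (N + 1))).take N).length = N := fun k => by
      have : (k + 1 : ℕ) * (N + 1) ≤ (K + 1) * (N + 1) := Nat.mul_le_mul_right _ k.2
      have h' : (k + 1 : ℕ) * (N + 1) = k * (N + 1) + (N + 1) := by ring
      simp only [List.length_take, List.length_drop]
      omega
    let g : Fin (K + 1) → List.Vector A N := fun k => ⟨(w.drop (k * (N + 1))).take N, hlen k⟩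
    obtain ⟨a, b, hne, hab⟩ := Fintype.exists_ne_map_eq_of_card_lt g (by simp [card_vector, hK])
    wlog hlt : a < b generalizing a b
    · exact this b a hne.symm hab.symm (lt_of_le_of_ne (not_lt.1 hlt) hne.symm)
    have hab' : (w.drop (a * (N + 1))).take N = (w.drop (b * (N + 1))).take N :=
      congrArg Subtype.val hab
    set y := (w.drop (a * (N + 1))).take N with hy
    obtain ⟨f, hf, s, t, hst⟩ := hN y (hlen a).ge
    set e := (b * (N + 1) - a * (N + 1) - N : ℕ) with he
    have hmul : (a + 1 : ℕ) * (N + 1) ≤ b * (N + 1) := Nat.mul_le_mul_right _ hlt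
    have hmul' : (a + 1 : ℕ) * (N + 1) = a * (N + 1) + (N + 1) := by ring
    set x := (w.drop (a * (N + 1) + N)).take e with hx
    have hxne : x ≠ [] := by
      have hb : (b + 1 : ℕ) * (N + 1) ≤ (K + 1) * (N + 1) := Nat.mul_le_mul_right _ b.2
      have hb' : (b + 1 : ℕ) * (N + 1) = b * (N + 1) + (N + 1) := by ring
      apply List.ne_nil_of_length_pos
      simp only [hx, List.length_take, List.length_drop]
      omega
    have hw1 : w = w.take (a * (N + 1)) ++ y ++ x ++ y ++ w.drop (b * (N + 1) + N) := by
      have h1 : w.drop (b * (N + 1)) = y ++ w.drop (b * (N + 1) + N) := by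
        rw [hab', ← List.drop_drop (i := N), List.take_append_drop]
      have h2 : w.drop (a * (N + 1) + N) = x ++ w.drop (b * (N + 1)) := by
        have : b * (N + 1) = a * (N + 1) + N + e := by omega
        rw [this, ← List.drop_drop (i := e), hx, List.take_append_drop]
      have h3 : w.drop (a * (N + 1)) = y ++ w.drop (a * (N + 1) + N) := by
        rw [← List.drop_drop (i := N), List.take_append_drop]
      conv_lhs => rw [← List.take_append_drop (a * (N + 1)) w, h3, h2, h1]
      simp only [List.append_assoc]
    -- With `y = s f(Z_i) t`, the factor `y x y` contains `f(Z_i) (t x s) f(Z_i)`.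
    refine ⟨Function.update f (i + 1) (t ++ x ++ s), fun v => ?_, ?_⟩
    · rcases eq_or_ne v (i + 1) with rfl | hv
      · simp [hxne]
      · simpa [Function.update_of_ne hv] using hf v
    · have hz : (zimin i).flatMap (Function.update f (i + 1) (t ++ x ++ s)) =
          (zimin i).flatMap f := by
        refine List.flatMap_congr fun v hv => ?_
        rw [Function.update_of_ne]
        have := lt_of_mem_zimin hv
        omega
      refine ⟨w.take (a * (N + 1)) ++ s, t ++ w.drop (b * (N + 1) + N), ?_⟩
      conv_rhs => rw [hw1, ← hst]
      simp [zimin, List.flatMap_append, hz, -List.append_assoc]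
      simp only [List.append_assoc]

theorem exists_forall_abelianEncounters_zimin {m : ℕ} (hm : 0 < m) (i : ℕ) :
    ∃ N : ℕ, ∀ w : List (Fin m), N ≤ w.length → AbelianEncounters (zimin i) w := by
  have : Nonempty (Fin m) := ⟨⟨0, hm⟩⟩
  obtain ⟨N, hN⟩ := exists_forall_zimin_flatMap_infix (Fin m) i
  refine ⟨N, fun w hw => ?_⟩
  obtain ⟨f, hf, h⟩ := hN w hw
  exact abelianEncounters_of_flatMap_infix f hf h

/-! ### Counting words with prescribed letter counts -/

/-- The words of length `n` over the alphabet `Fin m`. -/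
def wordsOfLength (m n : ℕ) : Finset (List (Fin m)) :=
  (Finset.univ : Finset (Fin n → Fin m)).image List.ofFn

theorem mem_wordsOfLength {m n : ℕ} {w : List (Fin m)} :
    w ∈ wordsOfLength m n ↔ w.length = n := by
  simp only [wordsOfLength, Finset.mem_image, Finset.mem_univ, true_and]
  constructor
  · rintro ⟨f, rfl⟩; simp
  · rintro rfl; exact ⟨w.get, List.ofFn_get w⟩

theorem card_wordsOfLength (m n : ℕ) : (wordsOfLength m n).card = m ^ n := by
  rw [wordsOfLength, Finset.card_image_of_injective _ List.ofFn_injective]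
  simp

theorem sum_count_eq_length {m : ℕ} (w : List (Fin m)) : ∑ a, w.count a = w.length := by
  simpa using Multiset.sum_count_eq_card (s := Finset.univ) (m := (w : Multiset (Fin m)))
    (fun _ _ => Finset.mem_univ _)

/-- The words in which each letter `a` occurs exactly `c a` times. -/
def wordsWithCounts {m : ℕ} (c : Fin m → ℕ) : Finset (List (Fin m)) :=
  (wordsOfLength m (∑ a, c a)).filter fun w => ∀ a, w.count a = c a

theorem mem_wordsWithCounts {m : ℕ} {c : Fin m → ℕ} {w : List (Fin m)} :
    w ∈ wordsWithCounts c ↔ ∀ a, w.count a = c a := by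
  simp only [wordsWithCounts, Finset.mem_filter, mem_wordsOfLength, and_iff_right_iff_imp]
  intro h
  rw [← sum_count_eq_length]
  exact Finset.sum_congr rfl fun a _ => h a

/-- Induction on the first letter `a`: deleting it lowers `c a` by one, and the contributions `c a *
l!` add up to `(l + 1)!`. The union bound needs only this direction. -/
theorem card_wordsWithCounts_mul_le {m : ℕ} (l : ℕ) (c : Fin m → ℕ) (hc : ∑ a, c a = l) :
    (wordsWithCounts c).card * ∏ a, (c a).factorial ≤ l.factorial := by
  induction l generalizing c with
  | zero =>
    have h0 : ∀ a, c a = 0 := by simpa using hc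
    have : wordsWithCounts c ⊆ {[]} := fun w hw => by
      have hw := mem_wordsWithCounts.1 hw
      rw [Finset.mem_singleton, ← List.length_eq_zero_iff, ← sum_count_eq_length]
      simp [hw, h0]
    simpa [h0] using Finset.card_le_card this
  | succ l ih =>
    set P := (Finset.univ : Finset (Fin m)).filter fun a => 0 < c a with hP
    have hsub : wordsWithCounts c ⊆ P.biUnion fun a =>
        (wordsWithCounts (Function.update c a (c a - 1))).image (List.cons a) := by
      intro w hw
      have hw := mem_wordsWithCounts.1 hw
      cases w with
      | nil => simp [← hw] at hc
      | cons a w =>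
        have ha : w.count a + 1 = c a := by simpa using hw a
        refine Finset.mem_biUnion.2 ⟨a, by simp [hP]; omega, Finset.mem_image.2 ⟨w, ?_, rfl⟩⟩
        refine mem_wordsWithCounts.2 fun b => ?_
        rcases eq_or_ne b a with rfl | hb
        · simp; omega
        · rw [Function.update_of_ne hb, ← hw b, List.count_cons_of_ne hb.symm]
    have hcard : (wordsWithCounts c).card ≤
        ∑ a ∈ P, (wordsWithCounts (Function.update c a (c a - 1))).card :=
      (Finset.card_le_card hsub).trans <| Finset.card_biUnion_le.trans <|
        Finset.sum_le_sum fun a _ => Finset.card_image_le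
    calc _ ≤ (∑ a ∈ P, (wordsWithCounts (Function.update c a (c a - 1))).card) *
          ∏ a, (c a).factorial := by gcongr
      _ = ∑ a ∈ P, (wordsWithCounts (Function.update c a (c a - 1))).card *
          ∏ a, (c a).factorial := Finset.sum_mul _ _ _
      _ ≤ ∑ a ∈ P, c a * l.factorial := by
        refine Finset.sum_le_sum fun a ha => ?_
        have ha : 0 < c a := by simpa [hP] using ha
        have hs : ∑ b, Function.update c a (c a - 1) b = l := by
          rw [Finset.sum_update_of_mem (Finset.mem_univ a)]
          rw [← Finset.add_sum_erase _ _ (Finset.mem_univ a)] at hc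
          rw [← Finset.erase_eq]
          omega
        have hf : ∏ b, (c b).factorial =
            c a * ∏ b, (Function.update c a (c a - 1) b).factorial := by
          rw [← Finset.mul_prod_erase _ _ (Finset.mem_univ a),
            ← Finset.mul_prod_erase _ (fun b => (Function.update c a (c a - 1) b).factorial)
              (Finset.mem_univ a), Function.update_self, ← mul_assoc,
            Nat.mul_factorial_pred ha.ne']
          congr 1
          refine Finset.prod_congr rfl fun b hb => ?_
          rw [Function.update_of_ne (Finset.ne_of_mem_erase hb)]
        rw [hf, mul_left_comm]
        exact Nat.mul_le_mul_left _ (ih _ hs)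
      _ ≤ ∑ a, c a * l.factorial := Finset.sum_le_univ_sum_of_nonneg (by simp)
      _ = (l + 1).factorial := by rw [← Finset.sum_mul, hc, Nat.factorial_succ]

theorem card_wordsWithCounts_le {m : ℕ} (c : Fin m → ℕ) :
    (wordsWithCounts c).card ≤ Nat.multinomial Finset.univ c := by
  refine Nat.le_of_mul_le_mul_right (c := ∏ a, (c a).factorial) ?_
    (Finset.prod_pos fun a _ => Nat.factorial_pos _)
  rw [mul_comm (Nat.multinomial _ _), Nat.multinomial_spec]
  exact card_wordsWithCounts_mul_le _ c rfl

/-! ### Counting abelian instances of Zimin patterns -/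

/-- The abelian instances of the Zimin pattern `Z_k` in which the variable `a_{v + 1}` is
replaced by words with letter counts `c v`. -/
def ziminInstances {m : ℕ} : (k : ℕ) → (Fin k → Fin m → ℕ) → Finset (List (Fin m))
  | 0, _ => {[]}
  | k + 1, c =>
    (ziminInstances k (Fin.init c) ×ˢ wordsWithCounts (c (Fin.last k)) ×ˢ
      ziminInstances k (Fin.init c)).image fun q => q.1 ++ q.2.1 ++ q.2.2

/-- The common length of the words in `ziminInstances k c`. -/
def ziminLength {m : ℕ} : (k : ℕ) → (Fin k → Fin m → ℕ) → ℕ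
  | 0, _ => 0
  | k + 1, c => 2 * ziminLength k (Fin.init c) + ∑ a, c (Fin.last k) a

theorem length_of_mem_ziminInstances {m k : ℕ} {c : Fin k → Fin m → ℕ} {w : List (Fin m)}
    (hw : w ∈ ziminInstances k c) : w.length = ziminLength k c := by
  induction k generalizing w with
  | zero => simpa [ziminInstances, ziminLength] using hw
  | succ k ih =>
    simp only [ziminInstances, Finset.mem_image, Finset.mem_product] at hw
    obtain ⟨⟨x, y, z⟩, ⟨hx, hy, hz⟩, rfl⟩ := hw
    have hx := ih hx
    have hz := ih hz
    have hy := (mem_wordsOfLength.1 (Finset.mem_filter.1 hy).1)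
    simp only [List.length_append, ziminLength] at *
    omega

theorem exists_of_forall₂_append_left {α β : Type*} {R : α → β → Prop} {l₁ l₂ : List α}
    {l : List β} (h : List.Forall₂ R (l₁ ++ l₂) l) :
    ∃ r₁ r₂, l = r₁ ++ r₂ ∧ List.Forall₂ R l₁ r₁ ∧ List.Forall₂ R l₂ r₂ :=
  ⟨l.take l₁.length, l.drop l₁.length, (List.take_append_drop _ _).symm,
    (List.forall₂_take_append l l₁ l₂ h.flip).flip, (List.forall₂_drop_append l l₁ l₂ h.flip).flip⟩

theorem flatten_mem_ziminInstances {m : ℕ} (C : ℕ → Fin m → ℕ) (k : ℕ)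
    (us : List (List (Fin m)))
    (h : List.Forall₂ (fun v u => ∀ a, u.count a = C v a) (zimin k) us) :
    us.flatten ∈ ziminInstances k (fun v : Fin k => C (v + 1)) := by
  induction k generalizing us with
  | zero =>
    simp only [zimin, List.forall₂_nil_left_iff] at h
    simp [h, ziminInstances]
  | succ k ih =>
    obtain ⟨_, zs, rfl, hxy, hz⟩ := exists_of_forall₂_append_left h
    obtain ⟨xs, _, rfl, hx, hy⟩ := exists_of_forall₂_append_left hxy
    rw [List.forall₂_cons_left_iff] at hy
    obtain ⟨y, _, hy, hnil, rfl⟩ := hy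
    rw [List.forall₂_nil_left_iff] at hnil
    subst hnil
    refine Finset.mem_image.2 ⟨(xs.flatten, y, zs.flatten), ?_, by simp⟩
    simp only [Finset.mem_product]
    exact ⟨ih xs hx, mem_wordsWithCounts.2 hy, ih zs hz⟩

/-- The exponent is the number of occurrences of `a_{v+1}` in `Z_k`; passing from `Z_k` to `Z_{k+1}`
squares the density and adds one new factor. -/
theorem card_ziminInstances_div_le {m : ℕ} (hm : 0 < m) (k : ℕ) (c : Fin k → Fin m → ℕ) :
    ((ziminInstances k c).card : ℝ) / (m : ℝ) ^ ziminLength k c ≤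
      ∏ v : Fin k, ((Nat.multinomial Finset.univ (c v) : ℝ) / (m : ℝ) ^ (∑ a, c v a)) ^
        2 ^ (k - 1 - v : ℕ) := by
  induction k with
  | zero => simp [ziminInstances, ziminLength]
  | succ k ih =>
    have hcard : (ziminInstances (k + 1) c).card ≤
        (ziminInstances k (Fin.init c)).card ^ 2 *
          Nat.multinomial Finset.univ (c (Fin.last k)) := by
      refine Finset.card_image_le.trans ?_
      rw [Finset.card_product, Finset.card_product]
      have := card_wordsWithCounts_le (c (Fin.last k))
      calc _ = (ziminInstances k (Fin.init c)).card ^ 2 *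
          (wordsWithCounts (c (Fin.last k))).card := by ring
        _ ≤ _ := by gcongr
    have hcard' : ((ziminInstances (k + 1) c).card : ℝ) ≤
        ((ziminInstances k (Fin.init c)).card : ℝ) ^ 2 *
          (Nat.multinomial Finset.univ (c (Fin.last k)) : ℝ) := by exact_mod_cast hcard
    rw [Fin.prod_univ_castSucc]
    calc _ ≤ (((ziminInstances k (Fin.init c)).card : ℝ) ^ 2 *
          (Nat.multinomial Finset.univ (c (Fin.last k)) : ℝ)) /
            (m : ℝ) ^ ziminLength (k + 1) c := by gcongr
      _ = (((ziminInstances k (Fin.init c)).card : ℝ) / (m : ℝ) ^ ziminLength k (Fin.init c)) ^ 2 *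
          ((Nat.multinomial Finset.univ (c (Fin.last k)) : ℝ) /
            (m : ℝ) ^ (∑ a, c (Fin.last k) a)) := by
        rw [ziminLength, pow_add, div_pow, ← pow_mul, mul_comm 2, mul_div_mul_comm]
      _ ≤ _ := by
        refine mul_le_mul ((pow_le_pow_left₀ (by positivity) (ih (Fin.init c)) 2).trans_eq ?_)
          (by simp) (by positivity) (by positivity)
        rw [← Finset.prod_pow]
        refine Finset.prod_congr rfl fun v _ => ?_
        rw [← pow_mul, ← pow_succ, Fin.val_castSucc]
        have : k - 1 - (v : ℕ) + 1 = k + 1 - 1 - v := by omega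
        rw [this]
        rfl

/-- The words of length `n` with a factor `x y z` preceded by `a` letters, where `x` and `z` are
abelian instances of `Z_k` with letter counts `c` and `y` has length `b`. -/
def wordsWithZiminFactor {m : ℕ} (n k : ℕ) (c : Fin k → Fin m → ℕ) (a b : ℕ) :
    Set (List (Fin m)) :=
  {w | w.length = n ∧ ∃ s x y z t, s.length = a ∧ x ∈ ziminInstances k c ∧ y.length = b ∧
    z ∈ ziminInstances k c ∧ w = s ++ (x ++ y ++ z) ++ t}

-- The data `a`, `b`, `c` fix all block lengths. The prefix, middle and suffix are free, so the two
-- copies of `Z_k` contribute the square of their density.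
open Classical in
theorem card_filter_wordsWithZiminFactor_le {m : ℕ} (hm : 0 < m) (n k : ℕ)
    (c : Fin k → Fin m → ℕ) (a b : ℕ) :
    (((wordsOfLength m n).filter (· ∈ wordsWithZiminFactor n k c a b)).card : ℝ) ≤
      (m : ℝ) ^ n * ∏ v : Fin k,
        ((Nat.multinomial Finset.univ (c v) : ℝ) / (m : ℝ) ^ (∑ i, c v i)) ^ 2 ^ (k - v : ℕ) := by
  set F := (wordsOfLength m n).filter (· ∈ wordsWithZiminFactor n k c a b) with hF
  set len := ziminLength k c with hlen
  have hm' : (0 : ℝ) < m := by exact_mod_cast hm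
  -- A member of `F` is what shows that the blocks fit into length `n`.
  rcases F.eq_empty_or_nonempty with h0 | ⟨w₀, hw₀⟩
  · rw [h0]; simp only [Finset.card_empty, Nat.cast_zero]; positivity
  have hn : a + b + 2 * len ≤ n := by
    obtain ⟨-, h, s, x, y, z, t, hs, hx, hy, hz, rfl⟩ := Finset.mem_filter.1 hw₀
    have hx := length_of_mem_ziminInstances hx
    have hz := length_of_mem_ziminInstances hz
    simp only [List.length_append] at h
    omega
  obtain ⟨r, rfl⟩ := Nat.exists_eq_add_of_le hn
  have hsub : F ⊆ (wordsOfLength m a ×ˢ ziminInstances k c ×ˢ wordsOfLength m b ×ˢ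
      ziminInstances k c ×ˢ wordsOfLength m r).image
        fun q => q.1 ++ (q.2.1 ++ q.2.2.1 ++ q.2.2.2.1) ++ q.2.2.2.2 := by
    intro w hw
    obtain ⟨-, h, s, x, y, z, t, hs, hx, hy, hz, rfl⟩ := Finset.mem_filter.1 hw
    refine Finset.mem_image.2 ⟨(s, x, y, z, t), ?_, rfl⟩
    simp only [Finset.mem_product, mem_wordsOfLength]
    refine ⟨hs, hx, hy, hz, ?_⟩
    have hx := length_of_mem_ziminInstances hx
    have hz := length_of_mem_ziminInstances hz
    simp only [List.length_append] at h
    omega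
  have hcard := (Finset.card_le_card hsub).trans Finset.card_image_le
  simp only [Finset.card_product, card_wordsOfLength] at hcard
  have hcard' : (F.card : ℝ) ≤ (m : ℝ) ^ a * ((ziminInstances k c).card *
      ((m : ℝ) ^ b * ((ziminInstances k c).card * (m : ℝ) ^ r))) := by exact_mod_cast hcard
  calc (F.card : ℝ) ≤ _ := hcard'
    _ = (m : ℝ) ^ (a + b + 2 * len + r) *
        (((ziminInstances k c).card : ℝ) / (m : ℝ) ^ len) ^ 2 := by
      field_simp
      ring
    _ ≤ _ := by
      gcongr
      refine (pow_le_pow_left₀ (by positivity) (card_ziminInstances_div_le hm k c) 2).trans_eq ?_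
      rw [← Finset.prod_pow]
      refine Finset.prod_congr rfl fun v _ => ?_
      rw [← pow_mul, ← pow_succ]
      have : k - 1 - (v : ℕ) + 1 = k - v := by omega
      rw [this]

/-! ### The union bound -/

theorem succ_mem_zimin {i v : ℕ} (h : v < i) : v + 1 ∈ zimin i := by
  induction i with
  | zero => omega
  | succ i ih =>
    rcases Nat.lt_succ_iff_lt_or_eq.1 h with h | rfl
    · simp [zimin, ih h]
    · simp [zimin]

/-- The letter counts of the nonempty words of length at most `n`. -/
def letterCounts (m n : ℕ) : Finset (Fin m → ℕ) :=
  (Finset.range n).biUnion fun l => Finset.piAntidiag Finset.univ (l + 1)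

theorem count_mem_letterCounts {m n : ℕ} {u : List (Fin m)} (h0 : u ≠ []) (hn : u.length ≤ n) :
    (fun a => u.count a) ∈ letterCounts m n := by
  have := List.length_pos_of_ne_nil h0
  refine Finset.mem_biUnion.2 ⟨u.length - 1, Finset.mem_range.2 (by omega), ?_⟩
  rw [Finset.mem_piAntidiag, sum_count_eq_length]
  exact ⟨by omega, fun _ _ => Finset.mem_univ _⟩

theorem sum_letterCounts (m n k : ℕ) :
    ∑ c ∈ letterCounts m n, ((Nat.multinomial Finset.univ c : ℝ) / (m : ℝ) ^ (∑ i, c i)) ^ k =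
      ∑ l ∈ Finset.range n, multinomialTerm m k (l + 1) := by
  rw [letterCounts, Finset.sum_biUnion]
  · refine Finset.sum_congr rfl fun l _ => ?_
    rw [multinomialTerm_eq_sum]
    refine Finset.sum_congr rfl fun c hc => ?_
    rw [(Finset.mem_piAntidiag.1 hc).1]
  · intro l _ l' _ hne
    refine Finset.disjoint_left.2 fun c hc hc' => hne ?_
    have h := (Finset.mem_piAntidiag.1 hc).1
    have h' := (Finset.mem_piAntidiag.1 hc').1
    omega

/-- Blocks of the same variable share their letter counts. As `k > 0`, the last copy of `Z_k` is
nonempty, whence `a + (b + 1) < n`; this triangular range yields the factor 2 in the final bound. -/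
theorem exists_mem_wordsWithZiminFactor {m n k : ℕ} (hk : 0 < k) {w : List (Fin m)}
    (hw : w.length = n) (h : AbelianEncounters (zimin (k + 1)) w) :
    ∃ c ∈ Fintype.piFinset fun _ : Fin k => letterCounts m n, ∃ a ∈ Finset.range n,
      ∃ b ∈ Finset.range (n - 1 - a), w ∈ wordsWithZiminFactor n k c a (b + 1) := by
  obtain ⟨u, hne, hperm, s, t, hst⟩ := h
  have hex : ∀ v, ∃ d : Fin m → ℕ, ∀ j, (zimin (k + 1)).get j = v → ∀ a, (u j).count a = d a := by
    intro v
    by_cases hv : ∃ j, (zimin (k + 1)).get j = v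
    · obtain ⟨j, hj⟩ := hv
      exact ⟨fun a => (u j).count a, fun j' hj' a =>
        (hperm j' j (hj'.trans hj.symm)).count_eq a⟩
    · exact ⟨0, fun j hj => absurd ⟨j, hj⟩ hv⟩
  choose C hC using hex
  have hF : List.Forall₂ (fun v u => ∀ a, u.count a = C v a) (zimin (k + 1)) (List.ofFn u) := by
    rw [List.forall₂_iff_get]
    refine ⟨by simp, fun j h₁ h₂ a => ?_⟩
    simpa using hC _ ⟨j, h₁⟩ rfl a
  have hlen : ∀ j, (u j).length ≤ n := fun j => by
    have hsub : u j <:+: (List.ofFn u).flatten :=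
      List.infix_of_mem_flatten (List.mem_ofFn.2 ⟨j, rfl⟩)
    rw [← hw]
    exact (hsub.trans ⟨s, t, hst⟩).length_le
  have hmem : ∀ v < k + 1, C (v + 1) ∈ letterCounts m n := fun v hv => by
    obtain ⟨j, hj⟩ := List.get_of_mem (succ_mem_zimin hv)
    have : C (v + 1) = fun a => (u j).count a := funext fun a => (hC _ j hj a).symm
    rw [this]
    exact count_mem_letterCounts (hne j) (hlen j)
  obtain ⟨_, zs, hus, hxy, hz⟩ := exists_of_forall₂_append_left hF
  obtain ⟨xs, _, rfl, hx, hy⟩ := exists_of_forall₂_append_left hxy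
  rw [List.forall₂_cons_left_iff] at hy
  obtain ⟨y, _, hy, hnil, rfl⟩ := hy
  rw [List.forall₂_nil_left_iff] at hnil
  subst hnil
  have hne' : ∀ v ∈ List.ofFn u, v ≠ [] := fun v hv => by
    obtain ⟨j, rfl⟩ := List.mem_ofFn.1 hv
    exact hne j
  have hy0 : 0 < y.length := List.length_pos_of_ne_nil (hne' y (by simp [hus]))
  have hz0 : 0 < zs.flatten.length := by
    have h1 : 1 ∈ zimin k := succ_mem_zimin hk
    have : zs ≠ [] := by
      rintro rfl
      rw [List.forall₂_nil_right_iff] at hz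
      simp [hz] at h1
    obtain ⟨z, zs', rfl⟩ := List.exists_cons_of_ne_nil this
    have := List.length_pos_of_ne_nil (hne' z (by simp [hus]))
    simp; omega
  rw [hus] at hst
  have hst' : w = s ++ (xs.flatten ++ y ++ zs.flatten) ++ t := by
    rw [← hst]; simp
  have hlw : w.length = s.length + (xs.flatten.length + y.length + zs.flatten.length) +
      t.length := by
    rw [hst']; simp only [List.length_append]
  refine ⟨fun v => C (v + 1), Fintype.mem_piFinset.2 fun v => hmem v (by omega),
    s.length, Finset.mem_range.2 (by omega), y.length - 1, Finset.mem_range.2 (by omega), hw,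
    s, xs.flatten, y, zs.flatten, t, rfl, flatten_mem_ziminInstances C k xs hx, by omega,
    flatten_mem_ziminInstances C k zs hz, hst'⟩

theorem two_mul_sum_sum_range_const_le (n : ℕ) (x : ℝ) (hx : 0 ≤ x) :
    2 * ∑ a ∈ Finset.range n, ∑ _b ∈ Finset.range (n - 1 - a), x ≤ (n : ℝ) ^ 2 * x := by
  have h : (∑ a ∈ Finset.range n, (n - 1 - a)) * 2 ≤ n ^ 2 := by
    rw [Finset.sum_range_reflect (fun a => a) n, Finset.sum_range_id_mul_two, sq]
    exact Nat.mul_le_mul_left _ (Nat.sub_le _ _)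
  have h' : (∑ a ∈ Finset.range n, ((n - 1 - a : ℕ) : ℝ)) * 2 ≤ (n : ℝ) ^ 2 := by
    exact_mod_cast h
  simp only [Finset.sum_const, Finset.card_range, nsmul_eq_mul]
  rw [← Finset.sum_mul]
  nlinarith

/-- The union bound: if all words of length `n` encounter `Z_{k + 1}`, then the expected number of
encounters is at least `1`. -/
theorem two_le_sq_mul_prod_multinomialSeries {m n k : ℕ} (hm : 4 ≤ m) (hk : 0 < k)
    (h : ∀ w : List (Fin m), w.length = n → AbelianEncounters (zimin (k + 1)) w) :
    2 ≤ (n : ℝ) ^ 2 * ∏ j ∈ Finset.Icc 1 k, multinomialSeries m (2 ^ j) := by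
  classical
  have hm0 : 0 < m := by omega
  set P : (Fin k → Fin m → ℕ) → ℝ := fun c => ∏ v : Fin k,
    ((Nat.multinomial Finset.univ (c v) : ℝ) / (m : ℝ) ^ (∑ i, c v i)) ^ 2 ^ (k - v : ℕ) with hP
  set I := Fintype.piFinset fun _ : Fin k => letterCounts m n with hI
  have hsub : wordsOfLength m n ⊆ I.biUnion fun c => (Finset.range n).biUnion fun a =>
      (Finset.range (n - 1 - a)).biUnion fun b =>
        (wordsOfLength m n).filter (· ∈ wordsWithZiminFactor n k c a (b + 1)) := by
    intro w hw
    have hw' := mem_wordsOfLength.1 hw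
    obtain ⟨c, hc, a, ha, b, hb, hmem⟩ := exists_mem_wordsWithZiminFactor hk hw' (h w hw')
    simp only [Finset.mem_biUnion, Finset.mem_filter]
    exact ⟨c, hc, a, ha, b, hb, hw, hmem⟩
  have hcard : ((m ^ n : ℕ) : ℝ) ≤ ∑ c ∈ I, ∑ a ∈ Finset.range n, ∑ b ∈ Finset.range (n - 1 - a),
      (m : ℝ) ^ n * P c := by
    rw [← card_wordsOfLength]
    have h1 := (Finset.card_le_card hsub).trans <| Finset.card_biUnion_le.trans <|
      Finset.sum_le_sum fun c _ => Finset.card_biUnion_le.trans <|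
        Finset.sum_le_sum fun a _ => Finset.card_biUnion_le
    refine (Nat.cast_le (α := ℝ).2 h1).trans ?_
    push_cast
    exact Finset.sum_le_sum fun c _ => Finset.sum_le_sum fun a _ => Finset.sum_le_sum fun b _ =>
      card_filter_wordsWithZiminFactor_le hm0 n k c a (b + 1)
  have hP0 : ∀ c, 0 ≤ P c := fun c => by positivity
  have hmn : (0 : ℝ) < (m : ℝ) ^ n := by positivity
  have h2 : 2 ≤ (n : ℝ) ^ 2 * ∑ c ∈ I, P c := by
    refine le_of_mul_le_mul_left (a := (m : ℝ) ^ n) ?_ hmn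
    push_cast at hcard
    calc (m : ℝ) ^ n * 2 ≤ 2 * ∑ c ∈ I, ∑ a ∈ Finset.range n, ∑ b ∈ Finset.range (n - 1 - a),
          (m : ℝ) ^ n * P c := by linarith
      _ ≤ ∑ c ∈ I, (n : ℝ) ^ 2 * ((m : ℝ) ^ n * P c) := by
          rw [Finset.mul_sum]
          exact Finset.sum_le_sum fun c _ =>
            two_mul_sum_sum_range_const_le n _ (mul_nonneg hmn.le (hP0 c))
      _ = _ := by rw [← Finset.mul_sum, ← Finset.mul_sum]; ring
  -- The counts of different variables are chosen independently, so the sum of products factors.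
  have h3 : ∑ c ∈ I, P c =
      ∏ v : Fin k, ∑ l ∈ Finset.range n, multinomialTerm m (2 ^ (k - v : ℕ)) (l + 1) := by
    rw [hI, hP]
    simp only [← sum_letterCounts]
    rw [Finset.prod_univ_sum]
  have h4 : ∑ c ∈ I, P c ≤ ∏ v : Fin k, multinomialSeries m (2 ^ (k - v : ℕ)) := by
    rw [h3]
    refine Finset.prod_le_prod (fun v _ => Finset.sum_nonneg fun l _ => multinomialTerm_nonneg _ _ _)
      fun v _ => ?_
    refine (summable_multinomialTerm hm ?_).sum_le_tsum _ fun l _ => multinomialTerm_nonneg _ _ _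
    exact Nat.le_self_pow (by omega) 2
  have h5 : ∏ v : Fin k, multinomialSeries m (2 ^ (k - v : ℕ)) =
      ∏ j ∈ Finset.Icc 1 k, multinomialSeries m (2 ^ j) := by
    rw [Fin.prod_univ_eq_prod_range (fun v => multinomialSeries m (2 ^ (k - v : ℕ))) k]
    refine Finset.prod_nbij' (fun v => k - v) (fun j => k - j) ?_ ?_ ?_ ?_ fun _ _ => rfl
    all_goals
      intro v hv
      simp only [Finset.mem_range, Finset.mem_Icc] at hv ⊢
      omega
  rw [← h5]
  exact h2.trans (by gcongr)

theorem sqrt_le_abelianRamseyLength_zimin {m k : ℕ} (hm : 4 ≤ m) (hk : 0 < k) :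
    √(2 * ∏ j ∈ Finset.Icc 1 k, (multinomialSeries m (2 ^ j))⁻¹) ≤
      (abelianRamseyLength m (zimin (k + 1)) : ℝ) := by
  obtain ⟨N, hN⟩ := exists_forall_abelianEncounters_zimin (by omega : 0 < m) (k + 1)
  have hmem : abelianRamseyLength m (zimin (k + 1)) ∈
      {n : ℕ | ∀ w : List (Fin m), w.length = n → AbelianEncounters (zimin (k + 1)) w} :=
    Nat.sInf_mem ⟨N, fun w hw => hN w hw.ge⟩
  have h := two_le_sq_mul_prod_multinomialSeries hm hk hmem
  set P := ∏ j ∈ Finset.Icc 1 k, multinomialSeries m (2 ^ j)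
  -- Positivity comes from the union bound itself: otherwise its right side would be nonpositive.
  have hP : 0 < P := by
    by_contra hP
    have := mul_nonpos_of_nonneg_of_nonpos
      (sq_nonneg (abelianRamseyLength m (zimin (k + 1)) : ℝ)) (not_lt.1 hP)
    linarith
  rw [Finset.prod_inv_distrib]
  refine Real.sqrt_le_iff.2 ⟨by positivity, ?_⟩
  rwa [← div_eq_mul_inv, div_le_iff₀ hP]

theorem mainTheorem11 :
    -- the series `S_j` converge
    (∀ m : ℕ, 4 ≤ m → ∀ j : ℕ, 1 ≤ j →
      Summable (fun l : ℕ => multinomialTerm m (2 ^ j) (l + 1))) ∧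
    -- the abelian Ramsey lengths are defined
    (∀ m : ℕ, 4 ≤ m → ∀ i : ℕ, 1 ≤ i → ¬ AbelianAvoidable m (zimin i)) ∧
    -- the lower bound; `ε m i` is the `o(1)`, which tends to `0` as `m + i → ∞`
    ∃ ε : ℕ → ℕ → ℝ,
      Tendsto (fun q : ℕ × ℕ => ε q.1 q.2) cofinite (𝓝 0) ∧
      ∀ m : ℕ, 4 ≤ m → ∀ i : ℕ, 2 ≤ i →
        (1 + ε m i) *
            Real.sqrt (2 * ∏ j ∈ Finset.Icc 1 (i - 1), (multinomialSeries m (2 ^ j))⁻¹)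
          ≤ (abelianRamseyLength m (zimin i) : ℝ) := by
  -- The bound holds exactly, so the `o(1)` is taken to be 0.
  refine ⟨fun m hm j hj => summable_multinomialTerm hm (Nat.le_self_pow (by omega) 2),
    fun m hm i _ h => ?_, fun _ _ => 0, tendsto_const_nhds, fun m hm i hi => ?_⟩
  · obtain ⟨N, hN⟩ := exists_forall_abelianEncounters_zimin (by omega : 0 < m) i
    obtain ⟨w, hw, hw'⟩ := h N
    exact hw' (hN w hw)
  · obtain ⟨k, rfl⟩ := Nat.exists_eq_add_of_le' (by omega : 1 ≤ i)
    rw [add_zero, one_mul, Nat.add_sub_cancel]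
    exact sqrt_le_abelianRamseyLength_zimin hm (by omega)
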